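/- For each $k\ge 1$ consider $k$ alternatives; alternative $i$ yields observations $X_{i,j}=\mu_i+\sigma_i Y_{i,j}$, $j=1,2,\dots$, where the $Y_{i,j}$ are i.i.d. over all $i,j$, with a continuous (atomless) distribution, $\mathrm{E}[Y_{i,j}]=0$ and $\mathrm{Var}[Y_{i,j}]=1$. The means and standard deviations of alternatives $2,\dots,k$ may depend on $k$; alternative 1 is the same for all $k$. Assume there are positive constants $\gamma,\underline\sigma,\overline\sigma$, independent of $k$, such that $\mu_1-\mu_i\ge\gamma$ for $i=2,\dots,k$ and $\underline\sigma\le\sigma_i\le\overline\sigma$ for $i=1,\dots,k$. Let $f:\{1,2,\dots\}\to[0,\infty)$ satisfy $\lim_{n\to\infty}f(n)=0$, and put $U_i(n)=\frac1n\sum_{j=1}^n X_{i,j}+f(n)$ and $U_1^*=\inf_{n\ge1}U_1(n)$. The meta-UCB algorithm with budget $B$ takes one observation of every alternative; then, as long as the total number of observations is less than $B$, it takes one more observation of an alternative that maximizes $U_i(n_i)$, where $n_i$ is the current sample size of $i$; finally it selects an alternative with the largest $n_i$. Ties are broken arbitrarily. Let PCS be the probability that alternative 1 is selected. For $b>0$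 let $n^f(b)$ be a positive integer such that $f(n)<b$ for all $n\ge n^f(b)$, chosen left-continuously in $b$ (for example the smallest such integer), and for $x,y,z>0$ let $$C^f(x,y,z)=n^f\!\left(\tfrac{xy}{2z}\right)\exp\!\left(\frac{2z^2\pi^2}{3x^2\,n^f\!\left(\frac{xy}{2z}\right)}\right).$$ Let $B=ck$ with $c>2C^f(\gamma,\underline\sigma,\overline\sigma)$. Then the set $\{g\in(0,\gamma):2C^f(\gamma-g,\underline\sigma,\overline\sigma)\le c\}$ is non-empty, and with $\gamma_0$ its supremum, $$\liminf_{k\to\infty}\mathrm{PCS}\ \ge\ \Pr\{U_1^*\ge\mu_1-\gamma_0\}\ >\ 0.$$ In particular the meta-UCB algorithm is sample optimal: there are constants $\alpha\in(0,1)$ and $c>0$ such that $\liminf_{k\to\infty}\mathrm{PCS}>\alpha$ for $B=ck$. -/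

import Mathlib

open Filter Topology MeasureTheory ProbabilityTheory

noncomputable section

/-- The sample mean of the first `n` terms of the observation sequence `x`. -/
def sampleMean (x : ℕ → ℝ) (n : ℕ) : ℝ :=
  (∑ j ∈ Finset.range n, x j) / n

/-- The UCB value after `n` observations: sample mean plus exploration bonus. -/
def ucbValue (f : ℕ → ℝ) (x : ℕ → ℝ) (n : ℕ) : ℝ :=
  sampleMean x n + f n

/-- The infimum over all `n ≥ 1` of the UCB value process. It is taken in the extended reals, so
that it is the true infimum also on paths that are not bounded below. -/
def ucbInf (f : ℕ → ℝ) (x : ℕ → ℝ) : EReal :=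
  ⨅ n : ℕ, ⨅ _ : 1 ≤ n, ((ucbValue f x n : ℝ) : EReal)

/-- The exploration bonus function is non-negative on sample sizes `n ≥ 1` and vanishes at
infinity. -/
structure IsBonusFunction (f : ℕ → ℝ) : Prop where
  nonneg : ∀ n, 1 ≤ n → 0 ≤ f n
  tendsto_zero : Tendsto f atTop (𝓝 0)

/-- `b` is a possible output of the meta-UCB algorithm with alternatives `0, …, k - 1` and budget
`B` on the sample path on which alternative `i` has UCB value `U i m` after `m` observations.
Here `n t i` is the sample size of `i` after `t` rounds of the while loop, and `T` is the number of
rounds. Ties, both in the sampling rule and in the final selection, may be broken arbitrarily. -/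
def IsMetaUCBOutput (k : ℕ) (B : ℝ) (U : ℕ → ℕ → ℝ) (b : ℕ) : Prop :=
  ∃ (n : ℕ → ℕ → ℕ) (T : ℕ),
    (∀ i < k, n 0 i = 1) ∧
    (∀ t < T, ((∑ i ∈ Finset.range k, n t i : ℕ) : ℝ) < B ∧
      ∃ s < k, (∀ i < k, U i (n t i) ≤ U s (n t s)) ∧
        n (t + 1) = Function.update (n t) s (n t s + 1)) ∧
    B ≤ ((∑ i ∈ Finset.range k, n T i : ℕ) : ℝ) ∧
    b < k ∧ ∀ i < k, n T i ≤ n T b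

/-- `nf b` is a positive integer from which on `f` is below `b`. The choice is left-continuous
in `b`, as the choice of the smallest such integer is. -/
structure IsBonusThreshold (f : ℕ → ℝ) (nf : ℝ → ℕ) : Prop where
  one_le : ∀ b, 0 < b → 1 ≤ nf b
  lt_of_le : ∀ b, 0 < b → ∀ n, nf b ≤ n → f n < b
  left_continuous : ∀ b, 0 < b → ∀ᶠ b' in 𝓝[<] b, nf b' = nf b

/-- The constant `C^f(x, y, z)`, for the choice `nf` of thresholds for `f`. -/
def costConstant (nf : ℝ → ℕ) (x y z : ℝ) : ℝ :=
  (nf (x * y / (2 * z)) : ℝ) *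
    Real.exp (2 * z ^ 2 * Real.pi ^ 2 / (3 * x ^ 2 * (nf (x * y / (2 * z)) : ℝ)))

/-- Sample optimality, for an algorithm whose probability of correct selection with `k`
alternatives and budget `B` is `PCS k B`. -/
def IsSampleOptimal (PCS : ℕ → ℝ → ℝ) : Prop :=
  ∃ α ∈ Set.Ioo (0 : ℝ) 1, ∃ c > 0, α < liminf (fun k : ℕ => PCS k (c * k)) atTop

/-- The observations `Y i j` of the standardized reference variables are i.i.d. over all
alternatives `i` and all observation numbers `j`, with an atomless law of mean zero and unit
variance. -/
structure IsReferenceNoise {Ω : Type*} [MeasurableSpace Ω] (P : Measure Ω)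
    (Y : ℕ → ℕ → Ω → ℝ) : Prop where
  measurable : ∀ i j, Measurable (Y i j)
  indep : iIndepFun (fun (p : ℕ × ℕ) => Y p.1 p.2) P
  identDistrib : ∀ i j, IdentDistrib (Y i j) (Y 0 0) P P
  continuous_law : ∀ y : ℝ, P {ω | Y 0 0 ω = y} = 0
  memLp : MemLp (Y 0 0) 2 P
  mean_zero : ∫ ω, Y 0 0 ω ∂P = 0
  variance_one : variance (Y 0 0) P = 1

/-- The observation sequence `X_j = m + s Y_j` of an alternative with mean `m` and standard
deviation `s`. -/
def observations (m s : ℝ) (y : ℕ → ℝ) (j : ℕ) : ℝ :=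
  m + s * y j

end

/-!
On a path where every UCB value of the best alternative is at least `M = μ₁ - g`, an inferior
alternative is no longer sampled once its own UCB value has dropped below `M`. Write `x = γ - g`.
This has happened by the first time `T`, from `r = nf (x σlo / (2 σhi))` on, at which the mean of
the standardized noise is at most `a = x / (2 σhi)`. Wald's identities and the Cauchy-Schwarz
inequality give `E T ≤ r + 1 / a²`, which is less than `C^f(x, σlo, σhi) ≤ c / 2`. The times `T` of
different alternatives are i.i.d., so by the strong law of large numbers the inferior alternatives
eventually use less than half of the budget `c k`, and alternative `0` has the largest sample size.
The level `γ₀` itself is reached by monotone approximation because `U₁*` has no atom there, and the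
limiting probability is positive because a random walk with positive drift stays nonnegative forever
with positive probability.
-/

section IsIID

theorem comap_reindex_eq_iSup {Ω E ι κ : Type*} [MeasurableSpace E] (X : ι → Ω → E) (g : κ → ι) :
    MeasurableSpace.comap (fun ω k => X (g k) ω) MeasurableSpace.pi =
      ⨆ i ∈ Set.range g, MeasurableSpace.comap (X i) inferInstance := by
  simp only [MeasurableSpace.pi, MeasurableSpace.comap_iSup, MeasurableSpace.comap_comp, iSup_range]
  rfl

variable {Ω E F ι κ κ' : Type*} [MeasurableSpace Ω] [MeasurableSpace E] [MeasurableSpace F]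
  {P : Measure Ω}

/-- `X` is a family of independent and identically distributed random variables. The index type is
arbitrary, so that the same notion covers sequences and double arrays. -/
structure IsIID (P : Measure Ω) (X : ι → Ω → E) : Prop where
  measurable : ∀ i, Measurable (X i)
  indep : iIndepFun X P
  identDistrib : ∀ i j, IdentDistrib (X i) (X j) P P

namespace IsIID

variable {X : ι → Ω → E}

theorem precomp (hX : IsIID P X) {g : κ → ι} (hg : g.Injective) : IsIID P fun k => X (g k) where
  measurable k := hX.measurable (g k)
  indep := hX.indep.precomp hg
  identDistrib k l := hX.identDistrib (g k) (g l)

theorem comp (hX : IsIID P X) {φ : E → F} (hφ : Measurable φ) :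
    IsIID P fun i ω => φ (X i ω) where
  measurable i := hφ.comp (hX.measurable i)
  indep := hX.indep.comp (fun _ => φ) fun _ => hφ
  identDistrib i j := (hX.identDistrib i j).comp hφ

theorem measurable_reindex (hX : IsIID P X) (g : κ → ι) : Measurable fun ω k => X (g k) ω :=
  measurable_pi_lambda _ fun k => hX.measurable (g k)

theorem identDistrib_reindex (hX : IsIID P X) {g g' : κ → ι} (hg : g.Injective)
    (hg' : g'.Injective) :
    IdentDistrib (fun ω k => X (g k) ω) (fun ω k => X (g' k) ω) P P where
  aemeasurable_fst := (hX.measurable_reindex g).aemeasurable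
  aemeasurable_snd := (hX.measurable_reindex g').aemeasurable
  map_eq := by
    rw [(hX.precomp hg).indep.map_fun_eq_infinitePi_map (hX.precomp hg).measurable,
      (hX.precomp hg').indep.map_fun_eq_infinitePi_map (hX.precomp hg').measurable]
    congr! 2 with k
    exact (hX.identDistrib (g k) (g' k)).map_eq

theorem indepFun_reindex (hX : IsIID P X) {g : κ → ι} {g' : κ' → ι} (h : ∀ a b, g a ≠ g' b) :
    IndepFun (fun ω k => X (g k) ω) (fun ω k => X (g' k) ω) P := by
  rw [IndepFun_iff_Indep, comap_reindex_eq_iSup, comap_reindex_eq_iSup]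
  exact indep_iSup_of_disjoint (fun i => (hX.measurable i).comap_le) hX.indep.iIndep
    (Set.disjoint_range_iff.2 h)

theorem indep_past [Preorder ι] (hX : IsIID P X) (m : ι) :
    Indep (⨆ j ∈ Set.Iio m, MeasurableSpace.comap (X j) inferInstance)
      (MeasurableSpace.comap (X m) inferInstance) P := by
  have h := indep_iSup_of_disjoint (S := Set.Iio m) (T := {m})
    (fun i => (hX.measurable i).comap_le) hX.indep.iIndep (by simp)
  rwa [iSup_singleton] at h

end IsIID

end IsIID

section StrongLaw

variable {Ω E κ : Type*} [MeasurableSpace Ω] [MeasurableSpace E] {P : Measure Ω}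

theorem IsIID.ae_tendsto_sum_div {X : ℕ → Ω → ℝ} (hX : IsIID P X) (hint : Integrable (X 0) P) :
    ∀ᵐ ω ∂P, Tendsto (fun n : ℕ => (∑ j ∈ Finset.range n, X j ω) / n) atTop (𝓝 P[X 0]) :=
  strong_law_ae_real X hint (fun _ _ hij => hX.indep.indepFun hij) fun i => hX.identDistrib i 0

theorem IsIID.ae_tendsto_sum_atTop {X : ℕ → Ω → ℝ} (hX : IsIID P X)
    (hint : Integrable (X 0) P) (hpos : 0 < P[X 0]) :
    ∀ᵐ ω ∂P, Tendsto (fun n : ℕ => ∑ j ∈ Finset.range n, X j ω) atTop atTop := by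
  filter_upwards [hX.ae_tendsto_sum_div hint] with ω hω
  refine (hω.pos_mul_atTop hpos tendsto_natCast_atTop_atTop).congr' ?_
  filter_upwards [eventually_ne_atTop 0] with n hn
  exact div_mul_cancel₀ _ (Nat.cast_ne_zero.2 hn)

theorem IsIID.ae_tendsto_sum_rows_div {X : ℕ → κ → Ω → E}
    (hX : IsIID P fun p : ℕ × κ => X p.1 p.2) {φ : (κ → E) → ℝ} (hφ : Measurable φ)
    (hint : Integrable (fun ω => φ fun j => X 0 j ω) P) :
    ∀ᵐ ω ∂P, Tendsto (fun k : ℕ => (∑ i ∈ Finset.range k, φ fun j => X i j ω) / k) atTop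
      (𝓝 (∫ ω, φ (fun j => X 0 j ω) ∂P)) := by
  refine strong_law_ae_real (fun i ω => φ fun j => X i j ω) hint (fun i i' hne => ?_) fun i => ?_
  · exact (hX.indepFun_reindex (g := Prod.mk i) (g' := Prod.mk i')
      fun _ _ h => hne (congrArg Prod.fst h)).comp hφ hφ
  · exact (hX.identDistrib_reindex (Prod.mk_right_injective i) (Prod.mk_right_injective 0)).comp hφ

end StrongLaw

section FirstPassage

/-- The walk with steps `x` is negative at all times from `r` to `m`. -/
def StaysNeg (r m : ℕ) (x : ℕ → ℝ) : Prop :=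
  ∀ n, r ≤ n → n ≤ m → ∑ j ∈ Finset.range n, x j < 0

/-- The first time from `r` on at which the walk with steps `x` is nonnegative; its value is the
junk `0` if there is no such time. -/
noncomputable def firstNonneg (r : ℕ) (x : ℕ → ℝ) : ℕ :=
  sInf {n | r ≤ n ∧ 0 ≤ ∑ j ∈ Finset.range n, x j}

open Classical in
/-- The step number `m` of the walk with steps `x`, stopped at the first time from `r` on at which
it is nonnegative. -/
noncomputable def stoppedStep (r : ℕ) (x : ℕ → ℝ) (m : ℕ) : ℝ :=
  if StaysNeg r m x then x m else 0

theorem StaysNeg.mono {r m n : ℕ} {x : ℕ → ℝ} (h : StaysNeg r n x) (hmn : m ≤ n) :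
    StaysNeg r m x :=
  fun l hr hl => h l hr (hl.trans hmn)

theorem staysNeg_of_lt {r m : ℕ} (h : m < r) (x : ℕ → ℝ) : StaysNeg r m x :=
  fun _ hr hm => absurd (hr.trans hm) h.not_ge

theorem firstNonneg_spec {r : ℕ} {x : ℕ → ℝ} (h : ∃ n, r ≤ n ∧ 0 ≤ ∑ j ∈ Finset.range n, x j) :
    r ≤ firstNonneg r x ∧ 0 ≤ ∑ j ∈ Finset.range (firstNonneg r x), x j :=
  Nat.sInf_mem h

theorem lt_firstNonneg_iff {r m : ℕ} {x : ℕ → ℝ} :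
    m < firstNonneg r x ↔
      (∃ n, r ≤ n ∧ 0 ≤ ∑ j ∈ Finset.range n, x j) ∧ StaysNeg r m x := by
  refine ⟨fun h => ⟨Nat.nonempty_of_pos_sInf (m.zero_le.trans_lt h), fun n hr hn => ?_⟩,
    fun ⟨hex, hneg⟩ => ?_⟩
  · exact lt_of_not_ge fun h0 => Nat.notMem_of_lt_sInf (hn.trans_lt h) ⟨hr, h0⟩
  · obtain ⟨hr, h0⟩ := firstNonneg_spec hex
    exact lt_of_not_ge fun hm => (hneg _ hr hm).not_ge h0

theorem measurableSet_staysNeg {Ω : Type*} {mΩ : MeasurableSpace Ω} {ξ : ℕ → Ω → ℝ} {m : ℕ}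
    (hξ : ∀ j < m, Measurable (ξ j)) (r : ℕ) : MeasurableSet {ω | StaysNeg r m fun j => ξ j ω} := by
  simp only [StaysNeg, Set.ofPred_forall]
  refine .iInter fun n => .iInter fun _ => .iInter fun hn => ?_
  exact measurableSet_lt (Finset.measurable_fun_sum _ fun j hj =>
    hξ j ((Finset.mem_range.1 hj).trans_le hn)) measurable_const

theorem measurable_firstNonneg (r : ℕ) : Measurable (firstNonneg r) := by
  refine measurable_of_Ioi fun m => ?_
  have hset : firstNonneg r ⁻¹' Set.Ioi m =
      (⋃ n, {x | r ≤ n ∧ 0 ≤ ∑ j ∈ Finset.range n, x j}) ∩ {x | StaysNeg r m x} := by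
    ext x
    simp [lt_firstNonneg_iff]
  rw [hset]
  refine .inter (.iUnion fun n => (MeasurableSet.const _).inter ?_)
    (measurableSet_staysNeg (fun j _ => measurable_pi_apply j) r)
  exact measurableSet_le measurable_const
    (Finset.measurable_fun_sum _ fun j _ => measurable_pi_apply j)

theorem sum_stoppedStep_of_staysNeg {r n : ℕ} {x : ℕ → ℝ} (h : ∀ m < n, StaysNeg r m x) :
    ∑ m ∈ Finset.range n, stoppedStep r x m = ∑ m ∈ Finset.range n, x m :=
  Finset.sum_congr rfl fun m hm => if_pos (h m (Finset.mem_range.1 hm))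

-- After time `r` the stopped walk becomes positive by a single step starting below zero, so its
-- positive part is at most that step.
theorem sq_posPart_sum_stoppedStep_le {r n : ℕ} (hn : r ≤ n) (x : ℕ → ℝ) :
    max 0 (∑ m ∈ Finset.range n, stoppedStep r x m) ^ 2 ≤
      (∑ m ∈ Finset.range r, x m) ^ 2 + ∑ m ∈ Finset.Ico r n, stoppedStep r x m ^ 2 := by
  have sq_max_le {s t : ℝ} (h : s ≤ |t|) : max 0 s ^ 2 ≤ t ^ 2 :=
    sq_le_sq.2 ((abs_of_nonneg (le_max_left 0 s)).trans_le (max_le (abs_nonneg t) h))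
  induction n, hn using Nat.le_induction with
  | base =>
    rw [sum_stoppedStep_of_staysNeg fun m hm => staysNeg_of_lt hm x, Finset.Ico_self,
      Finset.sum_empty, add_zero]
    exact sq_max_le (le_abs_self _)
  | succ n hn ih =>
    rw [Finset.sum_range_succ, Finset.sum_Ico_succ_top hn]
    by_cases hs : StaysNeg r n x
    · have hneg : ∑ m ∈ Finset.range n, stoppedStep r x m < 0 := by
        rw [sum_stoppedStep_of_staysNeg fun m hm => hs.mono hm.le]
        exact hs n hn le_rfl
      have hstep := sq_max_le (t := stoppedStep r x n)
        ((add_le_of_nonpos_left hneg.le).trans (le_abs_self _))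
      have hpast : 0 ≤ ∑ m ∈ Finset.Ico r n, stoppedStep r x m ^ 2 :=
        Finset.sum_nonneg fun _ _ => sq_nonneg _
      linarith [sq_nonneg (∑ m ∈ Finset.range r, x m)]
    · have hzero : stoppedStep r x n = 0 := if_neg hs
      simpa only [hzero, add_zero, zero_pow two_ne_zero] using ih

variable {Ω : Type*} [MeasurableSpace Ω] {P : Measure Ω} {ξ : ℕ → Ω → ℝ}

namespace IsIID

theorem setIntegral_staysNeg (hξ : IsIID P ξ) (r m : ℕ) {φ : ℝ → ℝ} (hφ : Measurable φ) :
    ∫ ω in {ω | StaysNeg r m fun j => ξ j ω}, φ (ξ m ω) ∂P =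
      P.real {ω | StaysNeg r m fun j => ξ j ω} * ∫ ω, φ (ξ 0 ω) ∂P := by
  have hpast : MeasurableSet[⨆ j ∈ Set.Iio m, MeasurableSpace.comap (ξ j) inferInstance]
      {ω | StaysNeg r m fun j => ξ j ω} :=
    measurableSet_staysNeg (fun j hj => (comap_measurable (ξ j)).mono
      (le_iSup₂_of_le j hj le_rfl) le_rfl) r
  have hle : ⨆ j ∈ Set.Iio m, MeasurableSpace.comap (ξ j) inferInstance ≤ ‹MeasurableSpace Ω› :=
    iSup₂_le fun j _ => (hξ.measurable j).comap_le
  have hmean : ∫ ω, φ (ξ m ω) ∂P = ∫ ω, φ (ξ 0 ω) ∂P :=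
    ((hξ.identDistrib m 0).comp hφ).integral_eq
  rw [(hξ.indep_past m).setIntegral_eq_mul hle (hξ.measurable m).aemeasurable hpast
    hφ.aestronglyMeasurable, hmean]

theorem integral_comp_stoppedStep (hξ : IsIID P ξ) (r m : ℕ) {φ : ℝ → ℝ} (hφ : Measurable φ)
    (hφ0 : φ 0 = 0) :
    ∫ ω, φ (stoppedStep r (fun j => ξ j ω) m) ∂P =
      P.real {ω | StaysNeg r m fun j => ξ j ω} * ∫ ω, φ (ξ 0 ω) ∂P := by
  rw [← hξ.setIntegral_staysNeg r m hφ,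
    ← integral_indicator (measurableSet_staysNeg (fun j _ => hξ.measurable j) r)]
  congr with ω
  by_cases hω : StaysNeg r m fun j => ξ j ω <;> simp [stoppedStep, hω, hφ0]

theorem memLp_stoppedStep (hξ : IsIID P ξ) (hL2 : MemLp (ξ 0) 2 P) (r m : ℕ) :
    MemLp (fun ω => stoppedStep r (fun j => ξ j ω) m) 2 P :=
  ((hξ.identDistrib m 0).memLp_iff.2 hL2).indicator
    (measurableSet_staysNeg (fun j _ => hξ.measurable j) r)

variable [IsProbabilityMeasure P]

theorem integral_sq_sum (hξ : IsIID P ξ) (hL2 : MemLp (ξ 0) 2 P) (r : ℕ) :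
    ∫ ω, (∑ m ∈ Finset.range r, ξ m ω) ^ 2 ∂P = r * Var[ξ 0; P] + (r * P[ξ 0]) ^ 2 := by
  have hL2' (m : ℕ) : MemLp (ξ m) 2 P := (hξ.identDistrib m 0).memLp_iff.2 hL2
  have hmean : ∫ ω, (∑ m ∈ Finset.range r, ξ m) ω ∂P = r * P[ξ 0] := by
    simp only [Finset.sum_apply]
    rw [integral_finsetSum _ fun m _ => (hL2' m).integrable one_le_two]
    simp [(hξ.identDistrib _ 0).integral_eq]
  have hvar : Var[∑ m ∈ Finset.range r, ξ m; P] = r * Var[ξ 0; P] := by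
    rw [IndepFun.variance_sum (fun m _ => hL2' m) fun i _ j _ hij => hξ.indep.indepFun hij]
    simp [(hξ.identDistrib _ 0).variance_eq]
  have hsum : MemLp (∑ m ∈ Finset.range r, ξ m) 2 P := memLp_finsetSum' _ fun m _ => hL2' m
  rw [variance_eq_sub hsum, hmean] at hvar
  rw [← hvar, sub_add_cancel]
  simp only [Pi.pow_apply, Finset.sum_apply]

theorem integral_sum_stoppedStep (hξ : IsIID P ξ) (hL2 : MemLp (ξ 0) 2 P) (r n : ℕ) :
    ∫ ω, ∑ m ∈ Finset.range n, stoppedStep r (fun j => ξ j ω) m ∂P =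
      (∑ m ∈ Finset.range n, P.real {ω | StaysNeg r m fun j => ξ j ω}) * P[ξ 0] := by
  rw [integral_finsetSum _ fun m _ => (hξ.memLp_stoppedStep hL2 r m).integrable one_le_two,
    Finset.sum_mul]
  exact Finset.sum_congr rfl fun m _ => hξ.integral_comp_stoppedStep r m measurable_id rfl

theorem integral_sum_sq_stoppedStep (hξ : IsIID P ξ) (hL2 : MemLp (ξ 0) 2 P) {r n : ℕ}
    (hn : r ≤ n) :
    ∫ ω, ∑ m ∈ Finset.Ico r n, stoppedStep r (fun j => ξ j ω) m ^ 2 ∂P =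
      (∑ m ∈ Finset.range n, P.real {ω | StaysNeg r m fun j => ξ j ω} - r) *
        (Var[ξ 0; P] + P[ξ 0] ^ 2) := by
  have hfirst : ∑ m ∈ Finset.range r, P.real {ω | StaysNeg r m fun j => ξ j ω} = r := by
    rw [Finset.sum_congr rfl (g := fun _ => (1 : ℝ)) fun m hm => by
      simp only [staysNeg_of_lt (Finset.mem_range.1 hm), Set.ofPred_true, probReal_univ]]
    simp
  have hmoment : ∫ ω, ξ 0 ω ^ 2 ∂P = Var[ξ 0; P] + P[ξ 0] ^ 2 := by
    rw [variance_eq_sub hL2, sub_add_cancel]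
    rfl
  rw [integral_finsetSum _ fun m _ => (hξ.memLp_stoppedStep hL2 r m).integrable_sq,
    ← hmoment, ← Finset.sum_range_add_sum_Ico _ hn, hfirst, add_sub_cancel_left, Finset.sum_mul]
  exact Finset.sum_congr rfl fun m _ =>
    hξ.integral_comp_stoppedStep r m (φ := (· ^ 2)) (by fun_prop) (by norm_num)

end IsIID

theorem sq_integral_le_of_sq_posPart_le [IsProbabilityMeasure P] {V R : Ω → ℝ}
    (hV : Integrable V P) (hR : Integrable R P) (h0 : 0 ≤ P[V]) (hle : ∀ ω, max 0 (V ω) ^ 2 ≤ R ω) :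
    P[V] ^ 2 ≤ P[R] := by
  have hpos : Integrable (fun ω => max 0 (V ω)) P := (integrable_const 0).sup hV
  have hsq : Integrable (fun ω => max 0 (V ω) ^ 2) P :=
    hR.mono' (hpos.aestronglyMeasurable.pow 2) (ae_of_all _ fun ω => by
      rw [Real.norm_of_nonneg (sq_nonneg _)]; exact hle ω)
  have hvar := variance_nonneg (fun ω => max 0 (V ω)) P
  rw [variance_eq_sub ((memLp_two_iff_integrable_sq hpos.aestronglyMeasurable).2 hsq),
    sub_nonneg] at hvar
  calc P[V] ^ 2 ≤ (∫ ω, max 0 (V ω) ∂P) ^ 2 :=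
        pow_le_pow_left₀ h0 (integral_mono hV hpos fun ω => le_max_right _ _) 2
    _ ≤ ∫ ω, max 0 (V ω) ^ 2 ∂P := hvar
    _ ≤ P[R] := integral_mono hsq hR hle

-- Wald's identities for the stopped walk, whose positive part has the second moment bounded in
-- `sq_posPart_sum_stoppedStep_le`, turn the Cauchy-Schwarz inequality into a quadratic inequality
-- for the expected stopping time.
theorem IsIID.sum_measureReal_staysNeg_le [IsProbabilityMeasure P] (hξ : IsIID P ξ)
    (hL2 : MemLp (ξ 0) 2 P) (hd : 0 < P[ξ 0]) {r : ℕ} (hr : 1 ≤ r) {n : ℕ} (hn : r ≤ n) :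
    ∑ m ∈ Finset.range n, P.real {ω | StaysNeg r m fun j => ξ j ω} ≤
      r + Var[ξ 0; P] / P[ξ 0] ^ 2 := by
  have hmean := hξ.integral_sum_stoppedStep hL2 r n
  have hfirst := hξ.integral_sq_sum hL2 r
  have hlast := hξ.integral_sum_sq_stoppedStep hL2 hn
  set t := ∑ m ∈ Finset.range n, P.real {ω | StaysNeg r m fun j => ξ j ω}
  set d := P[ξ 0]
  set v := Var[ξ 0; P]
  have ht : 0 ≤ t := Finset.sum_nonneg fun _ _ => measureReal_nonneg
  have hfirst_int : Integrable (fun ω => (∑ m ∈ Finset.range r, ξ m ω) ^ 2) P :=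
    (memLp_finsetSum _ fun m _ => (hξ.identDistrib m 0).memLp_iff.2 hL2).integrable_sq
  have hlast_int :
      Integrable (fun ω => ∑ m ∈ Finset.Ico r n, stoppedStep r (fun j => ξ j ω) m ^ 2) P :=
    integrable_finsetSum _ fun m _ => (hξ.memLp_stoppedStep hL2 r m).integrable_sq
  have hquad : (t * d) ^ 2 ≤ r * v + (r * d) ^ 2 + (t - r) * (v + d ^ 2) := by
    rw [← hmean, ← hfirst, ← hlast, ← integral_add hfirst_int hlast_int]
    refine sq_integral_le_of_sq_posPart_le (integrable_finsetSum _ fun m _ =>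
      (hξ.memLp_stoppedStep hL2 r m).integrable one_le_two) (hfirst_int.add hlast_int) ?_
      fun ω => sq_posPart_sum_stoppedStep_le hn _
    exact hmean ▸ mul_nonneg ht hd.le
  have hv : v = v / d ^ 2 * d ^ 2 := by field_simp
  have hs : 0 ≤ v / d ^ 2 := div_nonneg (variance_nonneg _ _) (sq_nonneg d)
  set s := v / d ^ 2
  have hdiv : t * (t - s - 1) ≤ r * (r - 1) := by
    rw [hv] at hquad
    refine le_of_mul_le_mul_right ?_ (pow_pos hd 2)
    linarith
  have hr' : (1 : ℝ) ≤ r := Nat.one_le_cast.2 hr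
  by_contra! hlt
  exact hdiv.not_gt
    (mul_lt_mul'' (by linarith) (by linarith) r.cast_nonneg (sub_nonneg.2 hr'))

theorem lintegral_natCast_eq_tsum {τ : Ω → ℕ} (hτ : Measurable τ) :
    ∫⁻ ω, τ ω ∂P = ∑' m : ℕ, P {ω | m < τ ω} := by
  have hsum (n : ℕ) : (n : ENNReal) = ∑' m : ℕ, if m < n then 1 else 0 := by
    rw [tsum_eq_sum (s := Finset.range n) (by simp), Finset.sum_ite_of_true (by simp)]
    simp
  have hmeas (m : ℕ) : MeasurableSet {ω | m < τ ω} := measurableSet_lt measurable_const hτ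
  simp_rw [hsum (τ _)]
  rw [lintegral_tsum fun m => (Measurable.ite (hmeas m) measurable_const
    measurable_const).aemeasurable]
  refine tsum_congr fun m => ?_
  rw [← lintegral_indicator_one (hmeas m)]
  congr with ω
  simp [Set.indicator_apply]

namespace IsIID

variable [IsProbabilityMeasure P]

theorem lintegral_firstNonneg_le (hξ : IsIID P ξ) (hL2 : MemLp (ξ 0) 2 P) (hd : 0 < P[ξ 0])
    {r : ℕ} (hr : 1 ≤ r) :
    ∫⁻ ω, firstNonneg r (fun j => ξ j ω) ∂P ≤
      ENNReal.ofReal (r + Var[ξ 0; P] / P[ξ 0] ^ 2) := by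
  have htail (m : ℕ) : P {ω | m < firstNonneg r fun j => ξ j ω} ≤
      ENNReal.ofReal (P.real {ω | StaysNeg r m fun j => ξ j ω}) := by
    rw [ofReal_measureReal]
    exact measure_mono fun ω hω => (lt_firstNonneg_iff.1 hω).2
  rw [lintegral_natCast_eq_tsum (τ := fun ω => firstNonneg r fun j => ξ j ω)
    ((measurable_firstNonneg r).comp (hξ.measurable_reindex id))]
  refine (ENNReal.tsum_le_tsum htail).trans ?_
  rw [ENNReal.tsum_eq_iSup_nat]
  refine iSup_le fun n => ?_
  rw [← ENNReal.ofReal_sum_of_nonneg fun m _ => measureReal_nonneg]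
  refine ENNReal.ofReal_le_ofReal ?_
  calc ∑ m ∈ Finset.range n, P.real {ω | StaysNeg r m fun j => ξ j ω}
      ≤ ∑ m ∈ Finset.range (max r n), P.real {ω | StaysNeg r m fun j => ξ j ω} :=
        Finset.sum_le_sum_of_subset_of_nonneg (Finset.range_mono (le_max_right r n))
          fun m _ _ => measureReal_nonneg
    _ ≤ r + Var[ξ 0; P] / P[ξ 0] ^ 2 :=
        hξ.sum_measureReal_staysNeg_le hL2 hd hr (le_max_left r n)

theorem integrable_firstNonneg (hξ : IsIID P ξ) (hL2 : MemLp (ξ 0) 2 P) (hd : 0 < P[ξ 0])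
    {r : ℕ} (hr : 1 ≤ r) : Integrable (fun ω => (firstNonneg r fun j => ξ j ω : ℝ)) P := by
  refine ⟨(measurable_from_top.comp ((measurable_firstNonneg r).comp
    (hξ.measurable_reindex id))).aestronglyMeasurable, ?_⟩
  rw [hasFiniteIntegral_iff_ofReal (ae_of_all _ fun ω => Nat.cast_nonneg _)]
  simp only [ENNReal.ofReal_natCast]
  exact (hξ.lintegral_firstNonneg_le hL2 hd hr).trans_lt ENNReal.ofReal_lt_top

theorem integral_firstNonneg_le (hξ : IsIID P ξ) (hL2 : MemLp (ξ 0) 2 P) (hd : 0 < P[ξ 0])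
    {r : ℕ} (hr : 1 ≤ r) :
    ∫ ω, (firstNonneg r fun j => ξ j ω : ℝ) ∂P ≤ r + Var[ξ 0; P] / P[ξ 0] ^ 2 := by
  have hnonneg : 0 ≤ r + Var[ξ 0; P] / P[ξ 0] ^ 2 :=
    add_nonneg r.cast_nonneg (div_nonneg (variance_nonneg _ _) (sq_nonneg _))
  rw [integral_eq_lintegral_of_nonneg_ae (ae_of_all _ fun ω => Nat.cast_nonneg _)
    (hξ.integrable_firstNonneg hL2 hd hr).aestronglyMeasurable]
  simp only [ENNReal.ofReal_natCast]
  exact ENNReal.toReal_le_of_le_ofReal hnonneg (hξ.lintegral_firstNonneg_le hL2 hd hr)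

end IsIID

theorem IsIID.ae_eventually_sum_firstNonneg_lt [IsProbabilityMeasure P] {ξ : ℕ → ℕ → Ω → ℝ}
    (hξ : IsIID P fun p : ℕ × ℕ => ξ p.1 p.2) (hL2 : MemLp (ξ 0 0) 2 P) (hd : 0 < P[ξ 0 0])
    {r : ℕ} (hr : 1 ≤ r) {c : ℝ} (hc : r + Var[ξ 0 0; P] / P[ξ 0 0] ^ 2 < c) :
    ∀ᵐ ω ∂P, ∀ᶠ k : ℕ in atTop,
      ((∑ i ∈ Finset.range k, firstNonneg r fun j => ξ i j ω : ℕ) : ℝ) < c * k := by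
  have hrow : IsIID P (ξ 0) := hξ.precomp (Prod.mk_right_injective 0)
  have hmeas : Measurable fun x => (firstNonneg r x : ℝ) :=
    measurable_from_top.comp (measurable_firstNonneg r)
  filter_upwards [hξ.ae_tendsto_sum_rows_div hmeas
    (hrow.integrable_firstNonneg hL2 hd hr)] with ω hω
  filter_upwards [hω.eventually_lt_const ((hrow.integral_firstNonneg_le hL2 hd hr).trans_lt hc),
    eventually_gt_atTop 0] with k hk hk0
  rw [div_lt_iff₀ (Nat.cast_pos.2 hk0)] at hk
  exact_mod_cast hk

theorem IsIID.ae_forall_exists_nonneg {ι : Type*} [Countable ι] {ξ : ι → ℕ → Ω → ℝ}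
    (hξ : ∀ i, IsIID P (ξ i)) (hint : ∀ i, Integrable (ξ i 0) P) (hd : ∀ i, 0 < P[ξ i 0]) (r : ℕ) :
    ∀ᵐ ω ∂P, ∀ i, ∃ n, r ≤ n ∧ 0 ≤ ∑ j ∈ Finset.range n, ξ i j ω :=
  ae_all_iff.2 fun i => by
    filter_upwards [(hξ i).ae_tendsto_sum_atTop (hint i) (hd i)] with ω hω
    exact ((eventually_ge_atTop r).and (hω.eventually_ge_atTop 0)).exists

end FirstPassage

section PositiveDrift

variable {Ω : Type*} [MeasurableSpace Ω] {P : Measure Ω} [NeZero P]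

-- A walk drifting to infinity attains its minimum, and the walk seen from a time at which it does
-- has the law of the original walk.
theorem IsIID.measure_forall_sum_nonneg_pos {ξ : ℕ → Ω → ℝ} (hξ : IsIID P ξ)
    (hint : Integrable (ξ 0) P) (hd : 0 < P[ξ 0]) :
    0 < P {ω | ∀ n, 0 ≤ ∑ j ∈ Finset.range n, ξ j ω} := by
  set A : Set (ℕ → ℝ) := {x | ∀ n, 0 ≤ ∑ j ∈ Finset.range n, x j}
  have hA : MeasurableSet A := by
    simp only [A, Set.ofPred_forall]
    exact .iInter fun n => measurableSet_le measurable_const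
      (Finset.measurable_fun_sum _ fun j _ => measurable_pi_apply j)
  have hattained : ∀ᵐ ω ∂P, ∃ n, (fun j => ξ (n + j) ω) ∈ A := by
    filter_upwards [hξ.ae_tendsto_sum_atTop hint hd] with ω hω
    rw [← Nat.cofinite_eq_atTop] at hω
    obtain ⟨n, hn⟩ := hω.exists_forall_le
    refine ⟨n, fun k => ?_⟩
    have hk := hn (n + k)
    rwa [Finset.sum_range_add, le_add_iff_nonneg_right] at hk
  have hcover : P (⋃ n, {ω | (fun j => ξ (n + j) ω) ∈ A}) ≠ 0 := by
    have huniv : (⋃ n, {ω | (fun j => ξ (n + j) ω) ∈ A}) =ᵐ[P] Set.univ :=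
      eventuallyEq_univ.2 (hattained.mono fun ω hω => Set.mem_iUnion.2 hω)
    rw [measure_congr huniv]
    exact NeZero.ne _
  obtain ⟨n, hn⟩ := exists_measure_pos_of_not_measure_iUnion_null hcover
  have hshift := hξ.identDistrib_reindex (add_right_injective n) Function.injective_id
  exact hn.trans_eq (hshift.measure_mem_eq hA)

end PositiveDrift

section Atomless

variable {Ω : Type*} [MeasurableSpace Ω] {P : Measure Ω} [IsFiniteMeasure P]

theorem ae_add_ne_of_indepFun {G : Type*} [AddGroup G] [MeasurableSpace G] [MeasurableAdd₂ G]
    [MeasurableSingletonClass G] {X Z : Ω → G} (hX : Measurable X) (hZ : Measurable Z)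
    (hXZ : IndepFun X Z P) (hatom : ∀ z, P {ω | Z ω = z} = 0) (s : G) :
    ∀ᵐ ω ∂P, X ω + Z ω ≠ s := by
  have hs : MeasurableSet {p : G × G | p.1 + p.2 = s} :=
    measurable_add (measurableSet_singleton s)
  have hnull : P.map (fun ω => (X ω, Z ω)) {p : G × G | p.1 + p.2 = s} = 0 := by
    rw [hXZ.map_prod_eq_prod_map_map hX.aemeasurable hZ.aemeasurable, Measure.measure_prod_null hs]
    refine ae_of_all _ fun x => ?_
    have hfiber : Prod.mk x ⁻¹' {p : G × G | p.1 + p.2 = s} = {-x + s} := by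
      ext z
      simp [eq_neg_add_iff_add_eq]
    change P.map Z _ = 0
    rw [hfiber, Measure.map_apply hZ (measurableSet_singleton _)]
    exact hatom _
  rw [Measure.map_apply (hX.prodMk hZ) hs] at hnull
  exact measure_eq_zero_iff_ae_notMem.1 hnull

theorem IsIID.ae_sum_ne {X : ℕ → Ω → ℝ} (hX : IsIID P X) (hatom : ∀ x, P {ω | X 0 ω = x} = 0)
    (n : ℕ) (s : ℝ) : ∀ᵐ ω ∂P, ∑ j ∈ Finset.range (n + 1), X j ω ≠ s := by
  simp only [Finset.sum_range_succ]
  refine ae_add_ne_of_indepFun (Finset.measurable_fun_sum _ fun j _ => hX.measurable j)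
    (hX.measurable n) ?_ (fun x => ?_) s
  · have h := hX.indep.indepFun_finsetSum_of_notMem hX.measurable (s := Finset.range n)
      Finset.notMem_range_self
    rwa [Finset.sum_fn] at h
  · exact ((hX.identDistrib n 0).measure_mem_eq (measurableSet_singleton x)).trans (hatom x)

end Atomless

section Levels

theorem iInf_mem_insert_range_of_tendsto {α : Type*} [CompleteLinearOrder α] [TopologicalSpace α]
    [OrderTopology α] {u : ℕ → α} {l : α} (hu : Tendsto u atTop (𝓝 l)) :
    ⨅ n, u n ∈ insert l (Set.range u) :=
  hu.isCompact_insert_range.isClosed.closure_subset_iff.2 (Set.subset_insert _ _)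
    (sInf_mem_closure (Set.range_nonempty u))

variable {Ω : Type*} [MeasurableSpace Ω] {P : Measure Ω} [IsProbabilityMeasure P] {A : ℕ → Set Ω}

theorem measureReal_le_liminf_of_ae_eventually {E : Set Ω}
    (h : ∀ᵐ ω ∂P, ω ∈ E → ∀ᶠ k in atTop, ω ∈ A k) :
    P.real E ≤ liminf (fun k => P.real (A k)) atTop := by
  set D : ℕ → Set Ω := fun n => ⋂ k ≥ n, A k
  have hmono : Monotone D := fun n n' hn => Set.biInter_subset_biInter_left fun k hk => hn.trans hk
  have hlim : Tendsto (fun n => P.real (D n)) atTop (𝓝 (P.real (⋃ n, D n))) :=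
    (ENNReal.tendsto_toReal (measure_ne_top _ _)).comp (tendsto_measure_iUnion_atTop hmono)
  have hE : P.real E ≤ P.real (⋃ n, D n) := by
    refine ENNReal.toReal_mono (measure_ne_top _ _) (measure_mono_ae ?_)
    filter_upwards [h] with ω hω hωE
    obtain ⟨n, hn⟩ := eventually_atTop.1 (hω hωE)
    exact Set.mem_iUnion.2 ⟨n, Set.mem_iInter₂.2 hn⟩
  refine hE.trans ?_
  rw [← hlim.liminf_eq]
  refine liminf_le_liminf (Eventually.of_forall fun n => ?_) ?_ ?_
  · exact measureReal_mono (Set.biInter_subset_of_mem (le_refl n))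
  · exact isBoundedUnder_of ⟨0, fun _ => measureReal_nonneg⟩
  · exact (isBoundedUnder_of ⟨1, fun _ => measureReal_le_one⟩).isCoboundedUnder_ge

theorem measureReal_le_liminf_of_isLUB {I : Ω → EReal} {S : Set ℝ} {γ₀ m : ℝ} (hS : S.Nonempty)
    (hlub : IsLUB S γ₀) (hne : ∀ᵐ ω ∂P, I ω ≠ (m - γ₀ : ℝ))
    (hA : ∀ g ∈ S, ∀ᵐ ω ∂P, ((m - g : ℝ) : EReal) ≤ I ω → ∀ᶠ k in atTop, ω ∈ A k) :
    P.real {ω | ((m - γ₀ : ℝ) : EReal) ≤ I ω} ≤ liminf (fun k => P.real (A k)) atTop := by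
  obtain ⟨u, -, -, hu, huS⟩ := hlub.exists_seq_monotone_tendsto hS
  refine measureReal_le_liminf_of_ae_eventually ?_
  filter_upwards [ae_all_iff.2 fun n => hA (u n) (huS n), hne] with ω hall hω hle
  have hlevel : Tendsto (fun n => ((m - u n : ℝ) : EReal)) atTop (𝓝 (m - γ₀ : ℝ)) :=
    (continuous_coe_real_ereal.tendsto _).comp (hu.const_sub m)
  obtain ⟨n, hn⟩ := (hlevel.eventually_le_const (lt_of_le_of_ne hle hω.symm)).exists
  exact hall n hn

end Levels

section Algorithm

/-- The sample sizes `n t i` of the alternatives `i < k` after `t ≤ T` rounds of upper confidence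
bound sampling. This is the sampling rule of `IsMetaUCBOutput` without the budget. -/
structure IsUCBTrajectory (k T : ℕ) (U : ℕ → ℕ → ℝ) (n : ℕ → ℕ → ℕ) : Prop where
  init : ∀ i < k, n 0 i = 1
  step : ∀ t < T, ∃ s < k, (∀ i < k, U i (n t i) ≤ U s (n t s)) ∧
    n (t + 1) = Function.update (n t) s (n t s + 1)

namespace IsUCBTrajectory

variable {k T : ℕ} {U : ℕ → ℕ → ℝ} {n : ℕ → ℕ → ℕ}

theorem one_le (h : IsUCBTrajectory k T U n) {t : ℕ} (ht : t ≤ T) {i : ℕ} (hi : i < k) :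
    1 ≤ n t i := by
  induction t with
  | zero => exact (h.init i hi).ge
  | succ t ih =>
    obtain ⟨s, -, -, hs⟩ := h.step t ht
    rw [hs, Function.update_apply]
    split_ifs
    · exact Nat.le_add_left 1 _
    · exact ih (Nat.le_of_succ_le ht)

theorem le_of_lt (h : IsUCBTrajectory k T U n) {i j m : ℕ} {L : ℝ} (hi : i < k) (hj : j < k)
    (hL : ∀ l, 1 ≤ l → L ≤ U j l) (hm : 1 ≤ m) (hUm : U i m < L) {t : ℕ} (ht : t ≤ T) :
    n t i ≤ m := by
  induction t with
  | zero => exact (h.init i hi).trans_le hm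
  | succ t ih =>
    have ht' : t ≤ T := Nat.le_of_succ_le ht
    obtain ⟨s, -, hmax, hs⟩ := h.step t ht
    rw [hs, Function.update_apply]
    split_ifs with his
    · subst his
      refine (ih ht').lt_of_ne fun heq => ?_
      rw [← heq] at hUm
      exact hUm.not_ge ((hL _ (h.one_le ht' hj)).trans (hmax j hj))
    · exact ih ht'

end IsUCBTrajectory

theorem eq_of_two_mul_sum_lt_sum {ι : Type*} {s : Finset ι} {n N : ι → ℕ} {b j : ι}
    (hb : b ∈ s) (hj : j ∈ s) (hjb : n j ≤ n b) (hle : ∀ i ∈ s, i ≠ j → n i ≤ N i)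
    (hlt : 2 * ∑ i ∈ s, N i < ∑ i ∈ s, n i) : b = j := by
  classical
  by_contra hbj
  have hother : ∑ i ∈ s.erase j, n i ≤ ∑ i ∈ s, N i :=
    (Finset.sum_le_sum fun i hi =>
      hle i (Finset.mem_of_mem_erase hi) (Finset.ne_of_mem_erase hi)).trans
        (Finset.sum_le_sum_of_subset (Finset.erase_subset j s))
  have hbest : n j ≤ ∑ i ∈ s, N i :=
    (hjb.trans (hle b hb hbj)).trans (Finset.single_le_sum (fun _ _ => Nat.zero_le _) hb)
  rw [← Finset.add_sum_erase s n hj] at hlt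
  lia

theorem IsMetaUCBOutput.eq_zero {k : ℕ} {B : ℝ} {U : ℕ → ℕ → ℝ} {b : ℕ}
    (h : IsMetaUCBOutput k B U b) {L : ℝ} (hL : ∀ l, 1 ≤ l → L ≤ U 0 l) {N : ℕ → ℕ}
    (hN : ∀ i, 1 ≤ i → i < k → 1 ≤ N i ∧ U i (N i) < L)
    (hB : 2 * ((∑ i ∈ Finset.range k, N i : ℕ) : ℝ) < B) : b = 0 := by
  obtain ⟨n, T, hinit, hstep, hbudget, hbk, hb⟩ := h
  have htraj : IsUCBTrajectory k T U n := ⟨hinit, fun t ht => (hstep t ht).2⟩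
  have hk : 0 < k := b.zero_le.trans_lt hbk
  refine eq_of_two_mul_sum_lt_sum (Finset.mem_range.2 hbk) (Finset.mem_range.2 hk) (hb 0 hk)
    (fun i hi hi0 => ?_) (N := N) (by exact_mod_cast hB.trans_le hbudget)
  obtain ⟨hNi, hUi⟩ := hN i (Nat.one_le_iff_ne_zero.2 hi0) (Finset.mem_range.1 hi)
  exact htraj.le_of_lt (Finset.mem_range.1 hi) hk hL hNi hUi le_rfl

end Algorithm

section UCBValues

theorem le_ucbInf_iff {f x : ℕ → ℝ} {a : ℝ} :
    (a : EReal) ≤ ucbInf f x ↔ ∀ n, 1 ≤ n → a ≤ ucbValue f x n := by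
  simp only [ucbInf, le_iInf_iff, EReal.coe_le_coe_iff]

theorem ucbValue_observations (f : ℕ → ℝ) (m s : ℝ) (y : ℕ → ℝ) {n : ℕ} (hn : n ≠ 0) :
    ucbValue f (observations m s y) n = m + s * ((∑ j ∈ Finset.range n, y j) / n) + f n := by
  have hn' : (n : ℝ) ≠ 0 := Nat.cast_ne_zero.2 hn
  simp only [ucbValue, sampleMean, observations, Finset.sum_add_distrib, ← Finset.mul_sum,
    Finset.sum_const, Finset.card_range, nsmul_eq_mul]
  field_simp

theorem ucbInf_ne_of_tendsto {f x : ℕ → ℝ} {l a : ℝ} (hlim : Tendsto (ucbValue f x) atTop (𝓝 l))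
    (hl : l ≠ a) (hne : ∀ n, ucbValue f x (n + 1) ≠ a) : ucbInf f x ≠ a := by
  have hlim' : Tendsto (fun n => (ucbValue f x (n + 1) : EReal)) atTop (𝓝 l) :=
    (continuous_coe_real_ereal.tendsto l).comp (hlim.comp (tendsto_add_atTop_nat 1))
  have hmem := iInf_mem_insert_range_of_tendsto hlim'
  have hshift : ucbInf f x = ⨅ n, (ucbValue f x (n + 1) : EReal) :=
    iInf_ge_eq_iInf_nat_add (fun n => (ucbValue f x n : EReal)) 1
  rw [← hshift] at hmem
  intro ha
  rw [ha] at hmem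
  obtain h | ⟨n, hn⟩ := hmem
  · exact hl (EReal.coe_injective h).symm
  · exact hne n (EReal.coe_injective hn)

end UCBValues

section CostConstant

variable {f : ℕ → ℝ} {nf : ℝ → ℕ} {x y z : ℝ}

theorem costConstant_pos (hnf : IsBonusThreshold f nf) (hx : 0 < x) (hy : 0 < y) (hz : 0 < z) :
    0 < costConstant nf x y z := by
  have hr := hnf.one_le (x * y / (2 * z)) (by positivity)
  unfold costConstant
  positivity

theorem add_one_div_sq_lt_costConstant (hnf : IsBonusThreshold f nf) (hx : 0 < x) (hy : 0 < y)
    (hz : 0 < z) : nf (x * y / (2 * z)) + 1 / (x / (2 * z)) ^ 2 < costConstant nf x y z := by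
  have hr := hnf.one_le (x * y / (2 * z)) (by positivity)
  unfold costConstant
  set r := nf (x * y / (2 * z))
  set v := 2 * z ^ 2 * Real.pi ^ 2 / (3 * x ^ 2 * r) with hv
  have hr0 : (0 : ℝ) < r := Nat.cast_pos.2 hr
  have hv0 : 0 < v := by positivity
  have hpi : 1 ≤ Real.pi ^ 2 / 6 := by nlinarith [Real.pi_gt_three]
  have hrv : (r : ℝ) * v = Real.pi ^ 2 / 6 * (1 / (x / (2 * z)) ^ 2) := by
    rw [hv]
    field_simp
    norm_num
  calc (r : ℝ) + 1 / (x / (2 * z)) ^ 2 ≤ r + r * v := by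
        rw [hrv]
        gcongr
        exact le_mul_of_one_le_left (by positivity) hpi
    _ = r * (v + 1) := by ring
    _ < r * Real.exp v := mul_lt_mul_of_pos_left (Real.add_one_lt_exp hv0.ne') hr0

theorem continuousWithinAt_costConstant (hnf : IsBonusThreshold f nf) (hx : 0 < x) (hy : 0 < y)
    (hz : 0 < z) : ContinuousWithinAt (fun x' => costConstant nf x' y z) (Set.Iio x) x := by
  have hr : (nf (x * y / (2 * z)) : ℝ) ≠ 0 :=
    Nat.cast_ne_zero.2 (Nat.one_le_iff_ne_zero.1 (hnf.one_le _ (by positivity)))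
  have hscale : Tendsto (fun x' => x' * y / (2 * z)) (𝓝[<] x) (𝓝[<] (x * y / (2 * z))) :=
    (by fun_prop : Continuous fun x' => x' * y / (2 * z)).continuousWithinAt.tendsto_nhdsWithin
      fun x' (hx' : x' < x) => by
        simp only [Set.mem_Iio]
        gcongr
  have hcont : ContinuousAt (fun x' => (nf (x * y / (2 * z)) : ℝ) *
      Real.exp (2 * z ^ 2 * Real.pi ^ 2 / (3 * x' ^ 2 * (nf (x * y / (2 * z)) : ℝ)))) x := by
    have hden : 3 * x ^ 2 * (nf (x * y / (2 * z)) : ℝ) ≠ 0 := by positivity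
    fun_prop (disch := assumption)
  refine hcont.continuousWithinAt.congr_of_eventuallyEq ?_ rfl
  filter_upwards [hscale.eventually (hnf.left_continuous _ (by positivity))] with x' hx'
  rw [costConstant, hx']

theorem exists_costConstant_sub_lt (hnf : IsBonusThreshold f nf) (hx : 0 < x) (hy : 0 < y)
    (hz : 0 < z) {c : ℝ} (hc : costConstant nf x y z < c) :
    ∃ g ∈ Set.Ioo 0 x, costConstant nf (x - g) y z < c := by
  obtain ⟨x', hx', hx0, hlt⟩ :=
    (((continuousWithinAt_costConstant hnf hx hy hz).eventually_lt_const hc).and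
      (Ioo_mem_nhdsLT hx)).exists
  exact ⟨x - x', ⟨sub_pos.2 hlt, sub_lt_self x hx0⟩, by rwa [sub_sub_cancel]⟩

end CostConstant

section ReferenceNoise

theorem ucbValue_lt_of_sum_le {f : ℕ → ℝ} {nf : ℝ → ℕ} (hnf : IsBonusThreshold f nf)
    {x lo hi m s M : ℝ} (hx : 0 < x) (hlo : 0 < lo) (hs : lo ≤ s) (hs' : s ≤ hi)
    (hm : m + x ≤ M) {y : ℕ → ℝ} {n : ℕ} (hn : nf (x * lo / (2 * hi)) ≤ n)
    (hy : ∑ j ∈ Finset.range n, y j ≤ x / (2 * hi) * n) :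
    ucbValue f (observations m s y) n < M := by
  have hs0 : 0 < s := hlo.trans_le hs
  have hhi : 0 < hi := hs0.trans_le hs'
  have hlevel : 0 < x * lo / (2 * hi) := by positivity
  have hn1 : 1 ≤ n := (hnf.one_le _ hlevel).trans hn
  have hmean : (∑ j ∈ Finset.range n, y j) / n ≤ x / (2 * hi) :=
    (div_le_iff₀ (Nat.cast_pos.2 hn1)).2 hy
  have hnoise : s * ((∑ j ∈ Finset.range n, y j) / n) ≤ x / 2 :=
    calc s * ((∑ j ∈ Finset.range n, y j) / n) ≤ s * (x / (2 * hi)) := by gcongr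
      _ ≤ hi * (x / (2 * hi)) := by gcongr
      _ = x / 2 := by field_simp
  have hbonus : f n < x / 2 :=
    calc f n < x * lo / (2 * hi) := hnf.lt_of_le _ hlevel n hn
      _ ≤ x * hi / (2 * hi) := by gcongr; exact hs.trans hs'
      _ = x / 2 := by field_simp
  rw [ucbValue_observations f m s y (Nat.one_le_iff_ne_zero.1 hn1)]
  linarith

variable {Ω : Type*} [MeasurableSpace Ω] {P : Measure Ω} {Y : ℕ → ℕ → Ω → ℝ} {f : ℕ → ℝ}

namespace IsReferenceNoise

theorem isIID (hY : IsReferenceNoise P Y) : IsIID P fun p : ℕ × ℕ => Y p.1 p.2 where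
  measurable p := hY.measurable p.1 p.2
  indep := hY.indep
  identDistrib p q := (hY.identDistrib p.1 p.2).trans (hY.identDistrib q.1 q.2).symm

theorem isIID_row (hY : IsReferenceNoise P Y) (i : ℕ) : IsIID P (Y i) :=
  hY.isIID.precomp (Prod.mk_right_injective i)

theorem integral_eq_zero (hY : IsReferenceNoise P Y) (i j : ℕ) : P[Y i j] = 0 :=
  (hY.identDistrib i j).integral_eq.trans hY.mean_zero

variable [IsProbabilityMeasure P]

theorem integrable (hY : IsReferenceNoise P Y) (i j : ℕ) : Integrable (Y i j) P :=
  (hY.identDistrib i j).integrable_iff.2 (hY.memLp.integrable one_le_two)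

theorem integral_add_mul (hY : IsReferenceNoise P Y) (m s : ℝ) (i j : ℕ) :
    ∫ ω, m + s * Y i j ω ∂P = m := by
  rw [integral_add (integrable_const m) ((hY.integrable i j).const_mul s), integral_const_mul,
    hY.integral_eq_zero]
  simp

theorem ae_tendsto_ucbValue (hY : IsReferenceNoise P Y) (hf : Tendsto f atTop (𝓝 0)) (m s : ℝ)
    (i : ℕ) : ∀ᵐ ω ∂P, Tendsto (ucbValue f (observations m s fun j => Y i j ω)) atTop (𝓝 m) := by
  filter_upwards [(hY.isIID_row i).ae_tendsto_sum_div (hY.integrable i 0)] with ω hω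
  have hlim := ((hω.const_mul s).const_add m).add hf
  rw [hY.integral_eq_zero, mul_zero, add_zero, add_zero] at hlim
  refine hlim.congr' ?_
  filter_upwards [eventually_ne_atTop 0] with n hn
  rw [ucbValue_observations f m s _ hn]

theorem ae_ucbValue_ne (hY : IsReferenceNoise P Y) (m : ℝ) {s : ℝ} (hs : s ≠ 0) (i n : ℕ) (a : ℝ) :
    ∀ᵐ ω ∂P, ucbValue f (observations m s fun j => Y i j ω) (n + 1) ≠ a := by
  have hatom (y : ℝ) : P {ω | Y i 0 ω = y} = 0 :=
    ((hY.identDistrib i 0).measure_mem_eq (measurableSet_singleton y)).trans (hY.continuous_law y)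
  filter_upwards [(hY.isIID_row i).ae_sum_ne hatom n ((a - f (n + 1) - m) / s * (n + 1 : ℕ))]
    with ω hω ha
  refine hω ?_
  rw [← ha, ucbValue_observations f m s _ n.succ_ne_zero]
  field_simp
  ring

theorem ae_ucbInf_ne (hY : IsReferenceNoise P Y) (hf : Tendsto f atTop (𝓝 0)) {m s : ℝ}
    (hs : s ≠ 0) (i : ℕ) {a : ℝ} (ha : m ≠ a) :
    ∀ᵐ ω ∂P, ucbInf f (observations m s fun j => Y i j ω) ≠ a := by
  filter_upwards [hY.ae_tendsto_ucbValue hf m s i,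
    ae_all_iff.2 fun n => hY.ae_ucbValue_ne (f := f) m hs i n a] with ω hlim hne
  exact ucbInf_ne_of_tendsto hlim ha hne

theorem measureReal_le_ucbInf_pos (hY : IsReferenceNoise P Y) (hf : ∀ n, 1 ≤ n → 0 ≤ f n)
    (m s : ℝ) (i : ℕ) {g : ℝ} (hg : 0 < g) :
    0 < P.real {ω | ((m - g : ℝ) : EReal) ≤ ucbInf f (observations m s fun j => Y i j ω)} := by
  have hwalk : IsIID P fun j ω => g + s * Y i j ω :=
    (hY.isIID_row i).comp (φ := fun y => g + s * y) (by fun_prop)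
  have hint : Integrable (fun ω => g + s * Y i 0 ω) P :=
    (integrable_const g).add ((hY.integrable i 0).const_mul s)
  have hpos := hwalk.measure_forall_sum_nonneg_pos hint ((hY.integral_add_mul g s i 0).symm ▸ hg)
  refine ENNReal.toReal_pos (hpos.trans_le (measure_mono fun ω hω => ?_)).ne' (measure_ne_top _ _)
  refine le_ucbInf_iff.2 fun n hn => ?_
  have hsum : 0 ≤ n * g + s * ∑ j ∈ Finset.range n, Y i j ω := by
    simpa [Finset.sum_add_distrib, Finset.mul_sum] using hω n
  have hn0 : (0 : ℝ) < n := Nat.cast_pos.2 hn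
  have hmean : -g ≤ s * ((∑ j ∈ Finset.range n, Y i j ω) / n) := by
    rw [← mul_div_assoc, le_div_iff₀ hn0]
    linarith
  rw [ucbValue_observations f m s _ (Nat.one_le_iff_ne_zero.1 hn)]
  linarith [hf n hn]

theorem ae_firstNonneg (hY : IsReferenceNoise P Y) {a c : ℝ} (ha : 0 < a) {r : ℕ} (hr : 1 ≤ r)
    (hc : r + 1 / a ^ 2 < c) :
    ∀ᵐ ω ∂P, (∀ i, r ≤ firstNonneg r (fun j => a - Y i j ω) ∧
        ∑ j ∈ Finset.range (firstNonneg r fun j => a - Y i j ω), Y i j ω ≤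
          a * firstNonneg r fun j => a - Y i j ω) ∧
      ∀ᶠ k : ℕ in atTop,
        ((∑ i ∈ Finset.range k, firstNonneg r fun j => a - Y i j ω : ℕ) : ℝ) < c * k := by
  have harray : IsIID P fun p : ℕ × ℕ => fun ω => a - Y p.1 p.2 ω :=
    hY.isIID.comp (φ := fun y => a - y) (by fun_prop)
  have hL2 : MemLp (fun ω => a - Y 0 0 ω) 2 P := (memLp_const a).sub hY.memLp
  have hint (i : ℕ) : Integrable (fun ω => a - Y i 0 ω) P :=
    (integrable_const a).sub (hY.integrable i 0)
  have hmean (i : ℕ) : ∫ ω, a - Y i 0 ω ∂P = a := by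
    simpa [sub_eq_add_neg] using hY.integral_add_mul a (-1) i 0
  have hvar : Var[fun ω => a - Y 0 0 ω; P] = 1 := by
    rw [variance_const_sub hY.memLp.aestronglyMeasurable, hY.variance_one]
  filter_upwards [harray.ae_eventually_sum_firstNonneg_lt (ξ := fun i j ω => a - Y i j ω) hL2
      ((hmean 0).symm ▸ ha) hr (by rwa [hmean, hvar]),
    IsIID.ae_forall_exists_nonneg (ξ := fun i j ω => a - Y i j ω)
      (fun i => harray.precomp (Prod.mk_right_injective i)) hint
      (fun i => (hmean i).symm ▸ ha) r] with ω hsum hex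
  refine ⟨fun i => ?_, hsum⟩
  obtain ⟨hle, hnonneg⟩ := firstNonneg_spec (hex i)
  refine ⟨hle, ?_⟩
  simp only [Finset.sum_sub_distrib, Finset.sum_const, Finset.card_range, nsmul_eq_mul,
    sub_nonneg] at hnonneg
  rwa [mul_comm]

-- The inferior alternative `i` drops below the level `M` no later than the noise walk, whose steps
-- have mean `x / (2 * hi)` and unit variance, is nonnegative; the bonus is small by then.
theorem ae_eventually_output_eq_zero (hY : IsReferenceNoise P Y) {nf : ℝ → ℕ}
    (hnf : IsBonusThreshold f nf) {x lo hi m s M c : ℝ} (hx : 0 < x) (hlo : 0 < lo) (hhi : 0 < hi)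
    {μ σ : ℕ → ℕ → ℝ} (hμ₁ : ∀ k, 1 ≤ k → μ k 0 = m) (hσ₁ : ∀ k, 1 ≤ k → σ k 0 = s)
    (hμ : ∀ k i, 1 ≤ i → i < k → μ k i + x ≤ M)
    (hσ : ∀ k i, 1 ≤ i → i < k → lo ≤ σ k i ∧ σ k i ≤ hi)
    (hc : 2 * costConstant nf x lo hi ≤ c) {b : ℕ → Ω → ℕ}
    (hb : ∀ k, 1 ≤ k → ∀ ω, IsMetaUCBOutput k (c * k)
      (fun i => ucbValue f (observations (μ k i) (σ k i) fun j => Y i j ω)) (b k ω)) :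
    ∀ᵐ ω ∂P, (M : EReal) ≤ ucbInf f (observations m s fun j => Y 0 j ω) →
      ∀ᶠ k in atTop, b k ω = 0 := by
  have hr := hnf.one_le (x * lo / (2 * hi)) (by positivity)
  have hcost := (add_one_div_sq_lt_costConstant hnf hx hlo hhi).trans_le
    ((le_div_iff₀' two_pos).2 hc)
  filter_upwards [hY.ae_firstNonneg (by positivity) hr hcost] with ω ⟨hpassage, hsum⟩ hM
  filter_upwards [hsum, eventually_ge_atTop 1] with k hk hk1
  refine (hb k hk1 ω).eq_zero (L := M) (fun l hl => ?_)
    (fun i hi1 hik => ⟨hr.trans (hpassage i).1, ?_⟩) (by linarith)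
  · rw [hμ₁ k hk1, hσ₁ k hk1]
    exact le_ucbInf_iff.1 hM l hl
  · exact ucbValue_lt_of_sum_le hnf hx hlo (hσ k i hi1 hik).1 (hσ k i hi1 hik).2 (hμ k i hi1 hik)
      (hpassage i).1 (hpassage i).2

end IsReferenceNoise

end ReferenceNoise

/-- For each number `k` of alternatives, the alternatives are `0, …, k - 1`, where `0` is the best
one; `μ k i` and `σ k i` are the mean and standard deviation of alternative `i`. Alternative `0` is
the same for all `k`; the others may vary with `k`. `sel k B` is the alternative which the
algorithm returns with `k` alternatives and budget `B`. -/
theorem theorem1 {Ω : Type*} [MeasurableSpace Ω] (P : Measure Ω) [IsProbabilityMeasure P]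
    (f : ℕ → ℝ) (hf : IsBonusFunction f)
    (nf : ℝ → ℕ) (hnf : IsBonusThreshold f nf)
    (Y : ℕ → ℕ → Ω → ℝ) (hY : IsReferenceNoise P Y)
    (μ₁ σ₁ : ℝ) (μ σ : ℕ → ℕ → ℝ)
    (hμ₁ : ∀ k, 1 ≤ k → μ k 0 = μ₁) (hσ₁ : ∀ k, 1 ≤ k → σ k 0 = σ₁)
    (γ σlo σhi : ℝ) (hγ : 0 < γ) (hσlo : 0 < σlo) (hσhi : 0 < σhi)
    (hgap : ∀ k i, 1 ≤ i → i < k → γ ≤ μ₁ - μ k i)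
    (hσ : ∀ k i, i < k → σlo ≤ σ k i ∧ σ k i ≤ σhi)
    (sel : ℕ → ℝ → Ω → ℕ) (hsel_meas : ∀ k B, Measurable (sel k B))
    (hsel : ∀ k, 1 ≤ k → ∀ B ω, IsMetaUCBOutput k B
      (fun i => ucbValue f (observations (μ k i) (σ k i) (fun j => Y i j ω))) (sel k B ω))
    (c : ℝ) (hc : 2 * costConstant nf γ σlo σhi < c) :
    (∃ γ₀ : ℝ,
      IsLUB {g : ℝ | g ∈ Set.Ioo 0 γ ∧ 2 * costConstant nf (γ - g) σlo σhi ≤ c} γ₀ ∧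
      P.real {ω | ((μ₁ - γ₀ : ℝ) : EReal) ≤
          ucbInf f (observations μ₁ σ₁ (fun j => Y 0 j ω))} ≤
        liminf (fun k : ℕ => P.real {ω | sel k (c * k) ω = 0}) atTop ∧
      0 < P.real {ω | ((μ₁ - γ₀ : ℝ) : EReal) ≤
          ucbInf f (observations μ₁ σ₁ (fun j => Y 0 j ω))}) ∧
    IsSampleOptimal (fun k B => P.real {ω | sel k B ω = 0}) := by
  set S : Set ℝ := {g : ℝ | g ∈ Set.Ioo 0 γ ∧ 2 * costConstant nf (γ - g) σlo σhi ≤ c}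
  have hS : S.Nonempty := by
    obtain ⟨g, hg, hgc⟩ := exists_costConstant_sub_lt hnf hγ hσlo hσhi ((lt_div_iff₀' two_pos).2 hc)
    exact ⟨g, hg, ((lt_div_iff₀' two_pos).1 hgc).le⟩
  have hlub : IsLUB S (sSup S) := isLUB_csSup hS ⟨γ, fun g hg => hg.1.2.le⟩
  have hγ₀ : 0 < sSup S := hS.elim fun g hg => hg.1.1.trans_le (hlub.1 hg)
  have hσ₁_pos : 0 < σ₁ := hσ₁ 1 le_rfl ▸ hσlo.trans_le (hσ 1 0 one_pos).1
  have hliminf := measureReal_le_liminf_of_isLUB (A := fun k : ℕ => {ω | sel k (c * k) ω = 0})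
    hS hlub (hY.ae_ucbInf_ne hf.tendsto_zero hσ₁_pos.ne' 0 (sub_lt_self μ₁ hγ₀).ne') fun g hg =>
      hY.ae_eventually_output_eq_zero hnf (sub_pos.2 hg.1.2) hσlo hσhi hμ₁ hσ₁
        (fun k i hi hik => by linarith [hgap k i hi hik]) (fun k i _ hik => hσ k i hik) hg.2
        fun k hk => hsel k hk (c * k)
  have hpos := hY.measureReal_le_ucbInf_pos hf.nonneg μ₁ σ₁ 0 hγ₀
  refine ⟨⟨sSup S, hlub, hliminf, hpos⟩, _, ⟨half_pos hpos, ?_⟩, c, ?_,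
    (half_lt_self hpos).trans_le hliminf⟩
  · exact (half_lt_self hpos).trans_le measureReal_le_one
  · linarith [costConstant_pos hnf hγ hσlo hσhi]
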